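/- Let $G$ be a finite simple graph that is connected and bipartite, with vertices $v_1,\dots,v_n$, and let $\Phi=(G,\varphi)$ be a $\mathbb{T}$-gain graph on $G$: $\varphi$ assigns to each orientation $\overrightarrow{e_{i,j}}$ of each edge $v_iv_j$ of $G$ a complex number of modulus $1$, with $\varphi(\overrightarrow{e_{i,j}})=\varphi(\overrightarrow{e_{j,i}})^{-1}$. Let $A(\Phi)$ be the Hermitian $n\times n$ matrix with $(i,j)$ entry $\varphi(\overrightarrow{e_{i,j}})$ if $v_i$ and $v_j$ are adjacent and $0$ otherwise. Call $\Phi$ balanced if, for every oriented cycle of $G$, the product of the gains $\varphi$ of its oriented edges is $1$. Then the following are equivalent: 1. $A(\Phi)$ has exactly one positive eigenvalue, counted with multiplicity; 2. $G$ is a complete bipartite graph $K_{p,q}$ for some $p,q\ge 1$, and $\Phi$ is balanced; 3. $G$ is a complete bipartite graph $K_{p,q}$ for some $p,q\ge 1$, and $\Phi$ is switching equivalent to $(G,1)$, the gain graph on $G$ with all gains $1$; that is, $A((G,1))=UA(\Phi)U^{*}$ for some unitary diagonal matrix $U$. -/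

import Mathlib

/-- A `𝕋`-gain graph with underlying simple graph `G`: every oriented edge (dart) of `G` carries a
unit complex number, and reversing the orientation inverts it. -/
structure TGainGraph {V : Type*} (G : SimpleGraph V) where
  gain : G.Dart → Circle
  gain_symm : ∀ d : G.Dart, gain d.symm = (gain d)⁻¹

namespace TGainGraph

variable {V : Type*} {G : SimpleGraph V}

/-- The gain graph `(G, 1)`, all of whose gains are `1`. -/
noncomputable def allOne (G : SimpleGraph V) : TGainGraph G where
  gain := fun _ => 1
  gain_symm := fun _ => inv_one.symm

open Classical in
/-- The adjacency matrix `A(Φ)`. -/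
noncomputable def adjMatrix (Φ : TGainGraph G) : Matrix V V ℂ :=
  Matrix.of fun u v => if h : G.Adj u v then (Φ.gain ⟨(u, v), h⟩ : ℂ) else 0

theorem adjMatrix_isHermitian (Φ : TGainGraph G) : Φ.adjMatrix.IsHermitian := by
  ext u v
  by_cases h : G.Adj u v
  · have h2 : Φ.gain ⟨(v, u), h.symm⟩ = (Φ.gain ⟨(u, v), h⟩)⁻¹ := Φ.gain_symm ⟨(u, v), h⟩
    rw [Matrix.conjTranspose_apply]
    simp only [adjMatrix, Matrix.of_apply, h, h.symm, dif_pos, h2, Circle.coe_inv_eq_conj]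
    simp
  · have h2 : ¬ G.Adj v u := fun k => h k.symm
    simp [adjMatrix, Matrix.conjTranspose_apply, h, h2]

/-- The number of positive eigenvalues of `A(Φ)`, counted with multiplicity (the family
`Matrix.IsHermitian.eigenvalues`, indexed by the vertices, repeats eigenvalues accordingly). -/
noncomputable def numPosEigenvalues [Fintype V] [DecidableEq V] (Φ : TGainGraph G) : ℕ :=
  (Finset.univ.filter fun i : V => 0 < Φ.adjMatrix_isHermitian.eigenvalues i).card

/-- The gain of a walk: the product of the gains of the oriented edges it traverses. -/
noncomputable def walkGain (Φ : TGainGraph G) {u v : V} (p : G.Walk u v) : Circle :=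
  (p.darts.map Φ.gain).prod

/-- `Φ` is balanced: every oriented cycle has gain `1`. -/
def IsBalanced (Φ : TGainGraph G) : Prop :=
  ∀ (v : V) (c : G.Walk v v), c.IsCycle → Φ.walkGain c = 1

/-- Switching equivalence: `A(Φ') = U A(Φ) U*` for some unitary diagonal matrix `U`. -/
def SwitchingEquivalent [Fintype V] [DecidableEq V] (Φ Φ' : TGainGraph G) : Prop :=
  ∃ d : V → ℂ, Matrix.diagonal d ∈ Matrix.unitaryGroup V ℂ ∧
    Φ'.adjMatrix = Matrix.diagonal d * Φ.adjMatrix * (Matrix.diagonal d).conjTranspose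

end TGainGraph

/-- `G` is a complete bipartite graph `K_{p,q}`, with both parts nonempty. -/
def SimpleGraph.IsCompleteBipartiteGraph {V : Type*} (G : SimpleGraph V) : Prop :=
  ∃ p q : ℕ, 1 ≤ p ∧ 1 ≤ q ∧ Nonempty (G ≃g completeBipartiteGraph (Fin p) (Fin q))

/-!
The matrix `A(Φ)` of a bipartite gain graph is conjugate to `-A(Φ)` by the diagonal `±1` matrix of
a two-colouring, so its spectrum is symmetric about `0` and its rank is twice the number of positive
eigenvalues. Condition 1 therefore says that the rank is `2`.

If the rank is less than `4`, every `2 × 2` minor with rows in one colour class and columns in the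
other vanishes, because together with its conjugate transpose it makes up a `4 × 4` submatrix.
For a walk `u, v, w, x` this gives `A u v * A v w * A w x = A u x`: the ends `u` and `x` are
adjacent, and the edge between them carries the gain of the walk. By induction the gain of every
walk of odd length is the matrix entry at its ends. Hence opposite-coloured vertices of a connected
graph are adjacent, and removing one edge from a cycle shows that `Φ` is balanced.

Conversely, balance is equivalent to switching equivalence to `(G, 1)`: fixing a root in each
component, the gain of a walk from the root is a well-defined potential. Switching preserves the
rank, and the `0`-`1` adjacency matrix of `K_{p,q}` has at most two distinct rows.
-/

section Spectrum

theorem charpoly_neg {R n : Type*} [CommRing R] [Fintype n] [DecidableEq n] (A : Matrix n n R) :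
    (-A).charpoly = (-1) ^ Fintype.card n * A.charpoly.comp (-Polynomial.X) := by
  have hmap : (Polynomial.compRingHom (-Polynomial.X)).mapMatrix A.charmatrix =
      -(-A).charmatrix := by
    ext1 i j
    by_cases hij : i = j
    · subst hij
      simp only [RingHom.mapMatrix_apply, Matrix.map_apply, Matrix.charmatrix_apply_eq,
        Polynomial.coe_compRingHom_apply, Polynomial.sub_comp, Polynomial.X_comp,
        Polynomial.C_comp, Matrix.neg_apply, map_neg]
      ring
    · simp [Matrix.charmatrix_apply_ne, hij]
  rw [Matrix.charpoly, Matrix.charpoly, ← Polynomial.coe_compRingHom_apply, RingHom.map_det, hmap,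
    Matrix.det_neg, ← mul_assoc, ← mul_pow]
  simp

theorem charpoly_neg_eq_charpoly_of_two_coloring {R n : Type*} [CommRing R] [Fintype n]
    [DecidableEq n] {A : Matrix n n R} {c : n → Bool} (hA : ∀ i j, c i = c j → A i j = 0) :
    (-A).charpoly = A.charpoly := by
  let D : Matrix n n R := .diagonal fun i => if c i then 1 else -1
  have hD : D * D = 1 := by
    rw [Matrix.diagonal_mul_diagonal, ← Matrix.diagonal_one, Matrix.diagonal_eq_diagonal_iff]
    intro i
    split_ifs <;> simp
  have hconj : D * A * D = -A := by
    ext i j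
    have := hA i j
    cases hi : c i <;> cases hj : c j <;> simp_all [D]
  rw [← hconj, Matrix.charpoly_mul_comm, ← mul_assoc, hD, one_mul]

variable {𝕜 n : Type*} [RCLike 𝕜] [Fintype n] [DecidableEq n] {A : Matrix n n 𝕜}

theorem map_neg_eigenvalues (hA : A.IsHermitian) (h : (-A).charpoly = A.charpoly) :
    Finset.univ.val.map (-hA.eigenvalues) = Finset.univ.val.map hA.eigenvalues := by
  have hroots : (-A).charpoly.roots = A.charpoly.roots.map (fun x => -x) := by
    rw [charpoly_neg, ← Polynomial.roots_comp_neg_X]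
    simpa using Polynomial.roots_C_mul (A.charpoly.comp (-Polynomial.X))
      (pow_ne_zero (Fintype.card n) (neg_ne_zero.2 one_ne_zero))
  rw [h, hA.roots_charpoly_eq_eigenvalues, Multiset.map_map] at hroots
  refine Multiset.map_injective (RCLike.ofReal_injective (K := 𝕜)) ?_
  simpa [Multiset.map_map, Function.comp_def] using hroots.symm

theorem card_neg_eigenvalues_eq_card_pos_eigenvalues (hA : A.IsHermitian)
    (h : (-A).charpoly = A.charpoly) :
    (Finset.univ.filter fun i => hA.eigenvalues i < 0).card =
      (Finset.univ.filter fun i => 0 < hA.eigenvalues i).card := by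
  have hcount := congrArg (Multiset.countP (0 < ·)) (map_neg_eigenvalues hA h)
  simpa [Multiset.countP_map, Finset.card, Finset.filter] using hcount

theorem rank_eq_two_mul_card_pos_eigenvalues (hA : A.IsHermitian)
    (h : (-A).charpoly = A.charpoly) :
    A.rank = 2 * (Finset.univ.filter fun i => 0 < hA.eigenvalues i).card := by
  rw [hA.rank_eq_card_non_zero_eigs, Fintype.card_subtype, two_mul]
  nth_rewrite 2 [← card_neg_eigenvalues_eq_card_pos_eigenvalues hA h]
  rw [← Finset.card_union_of_disjoint, ← Finset.filter_or]
  · simp only [ne_iff_lt_or_gt, or_comm]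
  · exact Finset.disjoint_filter.2 fun i _ => lt_asymm

end Spectrum

theorem det_submatrix_eq_zero_of_rank_lt {K n k : Type*} [Field K] [StarRing K] [Fintype n]
    [Fintype k] [DecidableEq k] {A : Matrix n n K} (hA : A.IsHermitian) {r c : k → n}
    (hr : A.submatrix r r = 0) (hc : A.submatrix c c = 0) (hrank : A.rank < 2 * Fintype.card k) :
    (A.submatrix r c).det = 0 := by
  have hblock : A.submatrix (Sum.elim r c) (Sum.elim c r) =
      .fromBlocks (A.submatrix r c) 0 0 (A.submatrix r c).conjTranspose := by
    rw [Matrix.conjTranspose_submatrix, hA.eq]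
    ext (i | i) (j | j)
    exacts [rfl, congrFun₂ hr i j, congrFun₂ hc i j, rfl]
  by_contra hdet
  have hblock_det : (A.submatrix (Sum.elim r c) (Sum.elim c r)).det ≠ 0 := by
    rw [hblock, Matrix.det_fromBlocks_zero₂₁, Matrix.det_conjTranspose]
    exact mul_ne_zero hdet (star_ne_zero.2 hdet)
  have hle := A.rank_submatrix_le (Sum.elim r c) (Sum.elim c r)
  rw [Matrix.rank_of_det_ne_zero hblock_det, Fintype.card_sum] at hle
  lia

theorem matrix_rank_eq_zero_iff {K m n : Type*} [Field K] [Finite m] [Fintype n]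
    {A : Matrix m n K} : A.rank = 0 ↔ A = 0 := by
  classical
  rw [Matrix.rank, Submodule.finrank_eq_zero, LinearMap.range_eq_bot, ← Matrix.toLin'_apply',
    LinearEquiv.map_eq_zero_iff]

theorem diagonal_mem_unitaryGroup_iff_exists_circle {n : Type*} [Fintype n] [DecidableEq n]
    {d : n → ℂ} : Matrix.diagonal d ∈ Matrix.unitaryGroup n ℂ ↔
      ∃ θ : n → Circle, d = fun i => (θ i : ℂ) := by
  have hunitary : Matrix.diagonal d ∈ Matrix.unitaryGroup n ℂ ↔ ∀ i, ‖d i‖ = 1 := by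
    rw [Matrix.mem_unitaryGroup_iff, Matrix.star_eq_conjTranspose, Matrix.diagonal_conjTranspose,
      Matrix.diagonal_mul_diagonal, ← Matrix.diagonal_one, Matrix.diagonal_eq_diagonal_iff]
    refine forall_congr' fun i => ?_
    rw [Pi.star_apply, Complex.star_def, Complex.mul_conj']
    norm_cast
    exact pow_eq_one_iff_of_nonneg (norm_nonneg _) two_ne_zero
  rw [hunitary]
  constructor
  · exact fun hd => ⟨fun i => ⟨d i, mem_sphere_zero_iff_norm.2 (hd i)⟩, rfl⟩
  · rintro ⟨θ, rfl⟩ i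
    exact (θ i).norm_coe

theorem isCompleteBipartiteGraph_iff_exists_two_coloring {V : Type*} [Finite V]
    {G : SimpleGraph V} : G.IsCompleteBipartiteGraph ↔
      ∃ c : V → Bool, Function.Surjective c ∧ ∀ u v, G.Adj u v ↔ c u ≠ c v := by
  constructor
  · rintro ⟨p, q, hp, hq, ⟨f⟩⟩
    refine ⟨fun v => (f v).isLeft, ?_, fun u v => ?_⟩
    · rintro (_ | _)
      · exact ⟨f.symm (Sum.inr ⟨0, hq⟩), by simp⟩
      · exact ⟨f.symm (Sum.inl ⟨0, hp⟩), by simp⟩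
    · rw [← f.map_adj_iff]
      rcases hu : f u with _ | _ <;> rcases hv : f v with _ | _ <;> simp [hu, hv]
  · rintro ⟨c, hsurj, hadj⟩
    obtain ⟨a, ha⟩ := hsurj true
    obtain ⟨b, hb⟩ := hsurj false
    have : Nonempty {v // c v = true} := ⟨⟨a, ha⟩⟩
    have : Nonempty {v // ¬ c v = true} := ⟨⟨b, by simp [hb]⟩⟩
    let sides : completeBipartiteGraph {v // c v = true} {v // ¬ c v = true} ≃g G :=
      ⟨Equiv.sumCompl fun v => c v = true, by
        rintro (⟨x, hx⟩ | ⟨x, hx⟩) (⟨y, hy⟩ | ⟨y, hy⟩) <;> simp_all⟩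
    exact ⟨_, _, Nat.card_pos, Nat.card_pos, ⟨sides.symm.trans
      (SimpleGraph.completeBipartiteGraphCongr (Finite.equivFin _) (Finite.equivFin _))⟩⟩

theorem ne_bot_of_isCompleteBipartiteGraph {V : Type*} {G : SimpleGraph V}
    (hG : G.IsCompleteBipartiteGraph) : G ≠ ⊥ := by
  obtain ⟨p, q, hp, hq, ⟨f⟩⟩ := hG
  have hadj : (completeBipartiteGraph (Fin p) (Fin q)).Adj (.inl ⟨0, hp⟩) (.inr ⟨0, hq⟩) := by simp
  exact SimpleGraph.ne_bot_iff_exists_adj.2 ⟨_, _, f.symm.map_adj_iff.2 hadj⟩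

namespace TGainGraph

variable {V : Type*} {G : SimpleGraph V} (Φ : TGainGraph G)

theorem gain_swap {u v : V} (h : G.Adj u v) :
    Φ.gain ⟨(v, u), h.symm⟩ = (Φ.gain ⟨(u, v), h⟩)⁻¹ :=
  Φ.gain_symm ⟨(u, v), h⟩

theorem adjMatrix_of_adj {u v : V} (h : G.Adj u v) :
    Φ.adjMatrix u v = Φ.gain ⟨(u, v), h⟩ := by
  simp [adjMatrix, h]

theorem adjMatrix_of_not_adj {u v : V} (h : ¬ G.Adj u v) : Φ.adjMatrix u v = 0 := by
  simp [adjMatrix, h]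

theorem adjMatrix_ne_zero_iff {u v : V} : Φ.adjMatrix u v ≠ 0 ↔ G.Adj u v := by
  by_cases h : G.Adj u v <;> simp [adjMatrix, h]

theorem adjMatrix_mul_adjMatrix_symm {u v : V} (h : G.Adj u v) :
    Φ.adjMatrix u v * Φ.adjMatrix v u = 1 := by
  rw [Φ.adjMatrix_of_adj h, Φ.adjMatrix_of_adj h.symm, Φ.gain_swap h, ← Circle.coe_mul,
    mul_inv_cancel, Circle.coe_one]

@[simp]
theorem walkGain_nil (v : V) : Φ.walkGain (.nil : G.Walk v v) = 1 := rfl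

@[simp]
theorem walkGain_cons {u v w : V} (h : G.Adj u v) (p : G.Walk v w) :
    Φ.walkGain (.cons h p) = Φ.gain ⟨(u, v), h⟩ * Φ.walkGain p := by
  simp [walkGain]

theorem coe_walkGain_cons {u v w : V} (h : G.Adj u v) (p : G.Walk v w) :
    (Φ.walkGain (.cons h p) : ℂ) = Φ.adjMatrix u v * Φ.walkGain p := by
  rw [walkGain_cons, Circle.coe_mul, Φ.adjMatrix_of_adj h]

@[simp]
theorem walkGain_append {u v w : V} (p : G.Walk u v) (q : G.Walk v w) :
    Φ.walkGain (p.append q) = Φ.walkGain p * Φ.walkGain q := by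
  simp [walkGain]

@[simp]
theorem walkGain_reverse {u v : V} (p : G.Walk u v) :
    Φ.walkGain p.reverse = (Φ.walkGain p)⁻¹ := by
  induction p with
  | nil => simp
  | cons h p ih =>
    rw [SimpleGraph.Walk.reverse_cons, walkGain_append, ih, walkGain_cons, walkGain_cons,
      walkGain_nil, mul_one, mul_inv, mul_comm, Φ.gain_swap h]

variable {Φ}

/-- A path closed up by an edge is a cycle unless it is that very edge traversed backwards. -/
theorem IsBalanced.walkGain_cons_eq_one (hΦ : Φ.IsBalanced) {u v : V} (h : G.Adj u v)
    {p : G.Walk v u} (hp : p.IsPath) : Φ.walkGain (.cons h p) = 1 := by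
  by_cases hedge : s(u, v) ∈ p.edges
  · have hp_eq : p = h.symm.toWalk := hp.eq_adj_toWalk_of_mem_edges (Sym2.eq_swap ▸ hedge)
    simp [hp_eq, Φ.gain_swap h]
  · exact hΦ u _ ((SimpleGraph.Walk.cons_isCycle_iff p h).2 ⟨hp, hedge⟩)

theorem IsBalanced.walkGain_bypass [DecidableEq V] (hΦ : Φ.IsBalanced) {u v : V}
    (p : G.Walk u v) : Φ.walkGain p.bypass = Φ.walkGain p := by
  induction p with
  | nil => rfl
  | @cons u v w h p ih =>
    rw [SimpleGraph.Walk.bypass, walkGain_cons, ← ih]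
    split_ifs with hu
    · have hsplit := congrArg Φ.walkGain (p.bypass.take_spec hu)
      have hloop := hΦ.walkGain_cons_eq_one h (p.bypass_isPath.takeUntil hu)
      rw [walkGain_append] at hsplit
      rw [walkGain_cons] at hloop
      rw [← hsplit, ← mul_assoc, hloop, one_mul]
    · rw [walkGain_cons]

theorem IsBalanced.walkGain_closed_eq_one (hΦ : Φ.IsBalanced) {v : V} (p : G.Walk v v) :
    Φ.walkGain p = 1 := by
  classical
  have hbypass : p.bypass.Nil := SimpleGraph.Walk.isPath_iff_nil.1 p.bypass_isPath
  rw [← hΦ.walkGain_bypass, hbypass.eq_nil, walkGain_nil]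

theorem IsBalanced.walkGain_eq_walkGain (hΦ : Φ.IsBalanced) {u v : V} (p q : G.Walk u v) :
    Φ.walkGain p = Φ.walkGain q := by
  have hclosed := hΦ.walkGain_closed_eq_one (p.append q.reverse)
  rwa [walkGain_append, walkGain_reverse, mul_inv_eq_one] at hclosed

variable (Φ)

/-- `θ` is a potential of `Φ`: the gains are its coboundary, so that the gain of a walk is the
quotient of the potentials at its endpoints. A potential is exactly what is needed to switch `Φ` to
`(G, 1)`. -/
def IsPotential (θ : V → Circle) : Prop :=
  ∀ d : G.Dart, Φ.gain d = (θ d.fst)⁻¹ * θ d.snd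

variable {Φ}

theorem IsPotential.walkGain_eq {θ : V → Circle} (hθ : Φ.IsPotential θ) {u v : V}
    (p : G.Walk u v) : Φ.walkGain p = (θ u)⁻¹ * θ v := by
  induction p with
  | nil => simp
  | cons h p ih => rw [walkGain_cons, ih, hθ]; simp

theorem IsPotential.isBalanced {θ : V → Circle} (hθ : Φ.IsPotential θ) : Φ.IsBalanced :=
  fun v c _ => by rw [hθ.walkGain_eq, inv_mul_cancel]

theorem IsBalanced.exists_isPotential (hΦ : Φ.IsBalanced) : ∃ θ, Φ.IsPotential θ := by
  let root (v : V) : V := (G.connectedComponentMk v).out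
  have hroot (v : V) : G.Reachable (root v) v :=
    SimpleGraph.ConnectedComponent.exact (Quot.out_eq _)
  let θ (v : V) : Circle := Φ.walkGain (hroot v).some
  have hθ {r v : V} (h : root v = r) (p : G.Walk r v) : θ v = Φ.walkGain p := by
    subst h
    exact hΦ.walkGain_eq_walkGain _ _
  refine ⟨θ, fun d => ?_⟩
  have hroot_eq : root d.snd = root d.fst :=
    congrArg Quot.out (SimpleGraph.ConnectedComponent.sound d.adj.symm.reachable)
  rw [hθ hroot_eq ((hroot d.fst).some.concat d.adj), SimpleGraph.Walk.concat_eq_append]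
  simp [θ]

theorem switchingEquivalent_iff [Fintype V] [DecidableEq V] {Ψ : TGainGraph G} :
    Φ.SwitchingEquivalent Ψ ↔
      ∃ θ : V → Circle, ∀ e : G.Dart, Ψ.gain e = θ e.fst * Φ.gain e * (θ e.snd)⁻¹ := by
  have hentries (θ : V → Circle) :
      Ψ.adjMatrix = Matrix.diagonal (fun v => (θ v : ℂ)) * Φ.adjMatrix *
          (Matrix.diagonal fun v => (θ v : ℂ)).conjTranspose ↔
        ∀ e : G.Dart, Ψ.gain e = θ e.fst * Φ.gain e * (θ e.snd)⁻¹ := by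
    simp only [← Matrix.ext_iff, Matrix.diagonal_conjTranspose, Matrix.mul_diagonal,
      Matrix.diagonal_mul, Pi.star_apply]
    refine ⟨fun h e => ?_, fun h u v => ?_⟩
    · have he := h e.fst e.snd
      rw [Ψ.adjMatrix_of_adj e.adj, Φ.adjMatrix_of_adj e.adj] at he
      rw [← Circle.coe_inj, Circle.coe_mul, Circle.coe_mul, Circle.coe_inv_eq_conj]
      exact he
    · by_cases huv : G.Adj u v
      · rw [Ψ.adjMatrix_of_adj huv, Φ.adjMatrix_of_adj huv, h ⟨(u, v), huv⟩, Circle.coe_mul,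
          Circle.coe_mul, Circle.coe_inv_eq_conj]
        rfl
      · simp [adjMatrix_of_not_adj, huv]
  constructor
  · rintro ⟨d, hd, hΨ⟩
    obtain ⟨θ, rfl⟩ := diagonal_mem_unitaryGroup_iff_exists_circle.1 hd
    exact ⟨θ, (hentries θ).1 hΨ⟩
  · rintro ⟨θ, hθ⟩
    exact ⟨_, diagonal_mem_unitaryGroup_iff_exists_circle.2 ⟨θ, rfl⟩, (hentries θ).2 hθ⟩

theorem switchingEquivalent_allOne_iff_exists_isPotential [Fintype V] [DecidableEq V] :
    Φ.SwitchingEquivalent (allOne G) ↔ ∃ θ, Φ.IsPotential θ := by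
  rw [switchingEquivalent_iff]
  refine exists_congr fun θ => forall_congr' fun e => ?_
  rw [eq_mul_inv_iff_mul_eq, eq_inv_mul_iff_mul_eq, eq_comm]
  simp [allOne]

theorem isBalanced_iff_switchingEquivalent_allOne [Fintype V] [DecidableEq V] :
    Φ.IsBalanced ↔ Φ.SwitchingEquivalent (allOne G) := by
  rw [switchingEquivalent_allOne_iff_exists_isPotential]
  exact ⟨IsBalanced.exists_isPotential, fun ⟨_, hθ⟩ => hθ.isBalanced⟩

theorem SwitchingEquivalent.rank_adjMatrix_eq [Fintype V] [DecidableEq V] {Ψ : TGainGraph G}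
    (h : Φ.SwitchingEquivalent Ψ) : Ψ.adjMatrix.rank = Φ.adjMatrix.rank := by
  obtain ⟨d, hd, hΨ⟩ := h
  have hdet : IsUnit (Matrix.diagonal d).det := Matrix.UnitaryGroup.det_isUnit ⟨_, hd⟩
  rw [hΨ, Matrix.rank_mul_eq_left_of_isUnit_det, Matrix.rank_mul_eq_right_of_isUnit_det _ _ hdet]
  rw [Matrix.det_conjTranspose]
  exact hdet.star

theorem rank_adjMatrix_allOne_le_two [Fintype V] (hG : G.IsCompleteBipartiteGraph) :
    (allOne G).adjMatrix.rank ≤ 2 := by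
  obtain ⟨c, -, hadj⟩ := isCompleteBipartiteGraph_iff_exists_two_coloring.1 hG
  let M : Matrix Bool Bool ℂ := .of fun a b => if a ≠ b then 1 else 0
  have hM : (allOne G).adjMatrix = M.submatrix c c := by
    ext u v
    simp [adjMatrix, allOne, M, hadj]
  calc (allOne G).adjMatrix.rank = (M.submatrix c c).rank := by rw [hM]
    _ ≤ M.rank := M.rank_submatrix_le c c
    _ ≤ 2 := M.rank_le_card_width

variable [Fintype V] (Φ)

theorem rank_adjMatrix_eq_zero_iff : Φ.adjMatrix.rank = 0 ↔ G = ⊥ := by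
  rw [matrix_rank_eq_zero_iff]
  constructor
  · intro hzero
    ext u v
    simp [← Φ.adjMatrix_ne_zero_iff, hzero]
  · rintro rfl
    ext u v
    exact Φ.adjMatrix_of_not_adj id

theorem rank_adjMatrix_eq_two_mul_numPosEigenvalues [DecidableEq V] (hG : G.IsBipartite) :
    Φ.adjMatrix.rank = 2 * Φ.numPosEigenvalues := by
  have C : G.Coloring Bool := hG.toColoring (by simp)
  refine rank_eq_two_mul_card_pos_eigenvalues Φ.adjMatrix_isHermitian
    (charpoly_neg_eq_charpoly_of_two_coloring (c := C) fun u v huv => ?_)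
  exact Φ.adjMatrix_of_not_adj fun hadj => C.valid hadj huv

variable {Φ}

theorem adjMatrix_mul_mul_eq_of_rank_lt_four (hG : G.IsBipartite) (hrank : Φ.adjMatrix.rank < 4)
    {u v w x : V} (huv : G.Adj u v) (hvw : G.Adj v w) (hwx : G.Adj w x) :
    Φ.adjMatrix u v * (Φ.adjMatrix v w * Φ.adjMatrix w x) = Φ.adjMatrix u x := by
  have C : G.Coloring Bool := hG.toColoring (by simp)
  have hsame {r : Fin 2 → V} (hr : C (r 0) = C (r 1)) : Φ.adjMatrix.submatrix r r = 0 := by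
    ext i j
    refine Φ.adjMatrix_of_not_adj fun hadj => C.valid hadj ?_
    fin_cases i <;> fin_cases j <;> simp [hr]
  have hr : C u = C w := (Bool.eq_not.2 (C.valid huv)).trans (Bool.not_eq_iff.2 (C.valid hvw))
  have hc : C v = C x := (Bool.eq_not.2 (C.valid hvw)).trans (Bool.not_eq_iff.2 (C.valid hwx))
  have hminor := det_submatrix_eq_zero_of_rank_lt Φ.adjMatrix_isHermitian
    (r := ![u, w]) (c := ![v, x]) (hsame hr) (hsame hc) (by simpa using hrank)
  have hinv := Φ.adjMatrix_mul_adjMatrix_symm hvw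
  simp only [Matrix.det_fin_two, Matrix.submatrix_apply, Matrix.cons_val_zero,
    Matrix.cons_val_one] at hminor
  linear_combination Φ.adjMatrix v w * hminor + Φ.adjMatrix u x * hinv

theorem coe_walkGain_eq_adjMatrix_of_odd_length (hG : G.IsBipartite)
    (hrank : Φ.adjMatrix.rank < 4) {u v : V} (p : G.Walk u v) (hp : Odd p.length) :
    (Φ.walkGain p : ℂ) = Φ.adjMatrix u v := by
  match p with
  | .nil => simp at hp
  | .cons h .nil => simp [Φ.adjMatrix_of_adj h]
  | .cons h (.cons h' q) =>
    have hq := coe_walkGain_eq_adjMatrix_of_odd_length hG hrank q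
      (by simpa [Nat.odd_add_one] using hp)
    have hadj := Φ.adjMatrix_ne_zero_iff.1 (hq ▸ Circle.coe_ne_zero _)
    rw [coe_walkGain_cons, coe_walkGain_cons, hq]
    exact adjMatrix_mul_mul_eq_of_rank_lt_four hG hrank h h' hadj

theorem isBalanced_of_rank_lt_four (hG : G.IsBipartite) (hrank : Φ.adjMatrix.rank < 4) :
    Φ.IsBalanced := by
  rintro v (_ | ⟨h, p⟩) _
  · rfl
  have C : G.Coloring Bool := hG.toColoring (by simp)
  have hodd : Odd p.length := by
    have heven := (C.even_length_iff_congr (.cons h p)).2 Iff.rfl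
    simpa [Nat.even_add_one] using heven
  rw [← Circle.coe_eq_one, coe_walkGain_cons,
    coe_walkGain_eq_adjMatrix_of_odd_length hG hrank p hodd, Φ.adjMatrix_mul_adjMatrix_symm h]

theorem isCompleteBipartiteGraph_of_rank_lt_four (hconn : G.Preconnected) (hG : G.IsBipartite)
    (hne : G ≠ ⊥) (hrank : Φ.adjMatrix.rank < 4) : G.IsCompleteBipartiteGraph := by
  have C : G.Coloring Bool := hG.toColoring (by simp)
  have hadj (u v : V) : G.Adj u v ↔ C u ≠ C v := by
    refine ⟨C.valid, fun huv => ?_⟩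
    obtain ⟨p⟩ := hconn u v
    have hodd : Odd p.length := (C.odd_length_iff_not_congr p).2 (by grind)
    rw [← Φ.adjMatrix_ne_zero_iff, ← coe_walkGain_eq_adjMatrix_of_odd_length hG hrank p hodd]
    exact Circle.coe_ne_zero _
  obtain ⟨u, v, huv⟩ := SimpleGraph.ne_bot_iff_exists_adj.1 hne
  refine isCompleteBipartiteGraph_iff_exists_two_coloring.2 ⟨C, fun b => ?_, hadj⟩
  by_cases hb : C u = b
  · exact ⟨u, hb⟩
  · exact ⟨v, (Bool.eq_not.2 (C.valid huv).symm).trans (Bool.not_eq_iff.2 hb)⟩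

theorem IsBalanced.rank_adjMatrix_le_two (hΦ : Φ.IsBalanced) (hG : G.IsCompleteBipartiteGraph) :
    Φ.adjMatrix.rank ≤ 2 := by
  classical
  rw [← (isBalanced_iff_switchingEquivalent_allOne.1 hΦ).rank_adjMatrix_eq]
  exact rank_adjMatrix_allOne_le_two hG

variable (Φ) in
theorem numPosEigenvalues_eq_one_iff [DecidableEq V] (hconn : G.Preconnected)
    (hG : G.IsBipartite) :
    Φ.numPosEigenvalues = 1 ↔ G.IsCompleteBipartiteGraph ∧ Φ.IsBalanced := by
  have hrank := Φ.rank_adjMatrix_eq_two_mul_numPosEigenvalues hG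
  have hbot := Φ.rank_adjMatrix_eq_zero_iff
  constructor
  · intro hpos
    have hlt : Φ.adjMatrix.rank < 4 := by lia
    exact ⟨isCompleteBipartiteGraph_of_rank_lt_four hconn hG (hbot.not.1 (by lia)) hlt,
      isBalanced_of_rank_lt_four hG hlt⟩
  · rintro ⟨hK, hΦ⟩
    have hle := hΦ.rank_adjMatrix_le_two hK
    have hne : Φ.adjMatrix.rank ≠ 0 := hbot.not.2 (ne_bot_of_isCompleteBipartiteGraph hK)
    lia

end TGainGraph

theorem mainTheorem6 {V : Type*} [Fintype V] [DecidableEq V] (G : SimpleGraph V)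
    (hconn : G.Connected) (hbip : G.IsBipartite) (Φ : TGainGraph G) :
    (Φ.numPosEigenvalues = 1 ↔ G.IsCompleteBipartiteGraph ∧ Φ.IsBalanced) ∧
    (Φ.numPosEigenvalues = 1 ↔
      G.IsCompleteBipartiteGraph ∧ Φ.SwitchingEquivalent (TGainGraph.allOne G)) := by
  have hbalanced := Φ.numPosEigenvalues_eq_one_iff hconn.preconnected hbip
  refine ⟨hbalanced, ?_⟩
  rwa [← TGainGraph.isBalanced_iff_switchingEquivalent_allOne]
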